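/- For integers $n \ge 1$ and $q \ge 0$, consider the $(q:1)$ Waiter-Client game on the edge set of the complete graph $K_n$. In every round Waiter offers Client exactly $q+1$ edges of $K_n$ which have not been offered before; Client keeps one of them and the other $q$ are claimed by Waiter. When fewer than $q+1$ unoffered edges remain, all of them are claimed by Waiter and the game ends. Client's graph consists of all $n$ vertices and of all the edges kept by Client by the end of the game. There exist an absolute constant $c>0$ and an integer $n_0$ such that for every integer $n\ge n_0$, every real $\varepsilon$ (which may depend on $n$) with $0<\varepsilon<1$ and every integer $q\ge 0$ the following hold. (i) If $q\ge(1+\varepsilon)n$, then Client has a strategy which ensures, against every strategy of Waiter, that the order of a largest connected component of Client's graph is at most $c\,\varepsilon^{-2}\ln n$. (ii) If $q\le(1-\varepsilon)n$, then Waiter has a strategy which ensures, against every strategy of Client, that the order of a largest connected component of Client's graph is at least $\min\{n,\,2\varepsilon n-2\}$. -/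

import Mathlib

namespace WaiterClient

/-- The record of the rounds played so far, most recent round first. A round `(S, e)` consists of
the set `S` of elements offered by Waiter and of the element `e` of `S` kept by Client; the other
elements of `S` are claimed by Waiter. -/
abbrev History (α : Type*) := List (Finset α × α)

variable {α : Type*} [DecidableEq α]

/-- The elements of the board `X` which have not been offered in any round of the history. -/
def free (X : Finset α) : History α → Finset α
  | [] => X
  | (S, _) :: h => free X h \ S

/-- The elements claimed by Client during the history. -/
def clientClaims : History α → Finset α
  | [] => ∅
  | (_, e) :: h => insert e (clientClaims h)

/-- A strategy of Waiter in the `(q : 1)` game on the board `X`: as long as at least `q + 1`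
elements are free, it prescribes a set of exactly `q + 1` free elements to be offered. -/
structure WaiterStrategy (X : Finset α) (q : ℕ) where
  offer : History α → Finset α
  offer_subset : ∀ h : History α, q + 1 ≤ (free X h).card → offer h ⊆ free X h
  offer_card : ∀ h : History α, q + 1 ≤ (free X h).card → (offer h).card = q + 1

/-- A strategy of Client: it prescribes which one of the offered elements he keeps. -/
structure ClientStrategy (α : Type*) where
  pick : History α → Finset α → α
  pick_mem : ∀ (h : History α) (S : Finset α), S.Nonempty → pick h S ∈ S

/-- The history after `i` rounds. As soon as fewer than `q + 1` elements are free there are no more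
rounds: all the remaining elements are claimed by Waiter. -/
def play {X : Finset α} {q : ℕ} (W : WaiterStrategy X q) (C : ClientStrategy α) : ℕ → History α
  | 0 => []
  | i + 1 =>
    if q + 1 ≤ (free X (play W C i)).card then
      (W.offer (play W C i), C.pick (play W C i) (W.offer (play W C i))) :: play W C i
    else play W C i

/-- The elements claimed by Client at the end of the game. Every round uses up at least one element
of the board, so the game has at most `X.card` rounds. -/
def outcome {X : Finset α} {q : ℕ} (W : WaiterStrategy X q) (C : ClientStrategy α) : Finset α :=
  clientClaims (play W C X.card)

/-- The edge set of the complete graph `K_n`. -/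
def completeEdges (n : ℕ) : Finset (Sym2 (Fin n)) :=
  (⊤ : SimpleGraph (Fin n)).edgeFinset

/-- Client's graph at the end of the `(q : 1)` game on `E(K_n)`: its vertices are all the vertices
of `K_n` and its edges are the edges claimed by Client. -/
def clientGraph {n q : ℕ} (W : WaiterStrategy (completeEdges n) q)
    (C : ClientStrategy (Sym2 (Fin n))) : SimpleGraph (Fin n) :=
  SimpleGraph.fromEdgeSet (outcome W C : Set (Sym2 (Fin n)))

/-- The order (number of vertices) of a largest connected component of a finite graph. -/
noncomputable def largestComponentOrder {n : ℕ} (G : SimpleGraph (Fin n)) : ℕ :=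
  ⨆ K : G.ConnectedComponent, K.supp.ncard

end WaiterClient

/-! For (i), put p = 1/(q+1). Client plays a derandomised random graph of density p: with a
potential function he keeps the number of fully claimed members of any prescribed family at or below
its expectation (`exists_clientStrategy_countP_le`). The family encodes the r-th moment of the
component order. Each choice of a root and of r marked vertices in its component is witnessed by a
tree built by attaching r self-avoiding paths in turn. A component of order s therefore contains at
least s^r members, counted with multiplicity (`pow_le_countP_treeExtensions`). If pn ≤ 1 - δ, path
lengths contribute geometric series, so the expectation is at most n(δ⁻¹(1 + 4r/δ))^r
(`weight_treeExtensions_le`). Taking r about ln n and r-th roots gives O(ε⁻² ln n).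

For (ii), put a = q+1. Waiter grows one component C by a vertex per round and offers only edges
between C and its complement. He selects outer vertices whose free degrees to C sum to exactly a and
offers all their free edges to C. Whichever edge Client keeps, one selected vertex joins C, the
other selected ones have free degree 1, and the unselected ones gain 1. The multiset of free degrees
is thus independent of Client's choices, and an explicit schedule (`profile`) makes the sum a
attainable up to order 2·min(n - a, a). If n - a is the minimum, this is the target. Otherwise every
outer vertex now has at least a free edges to C, and they can be forced in one by one until C spans
the graph. -/

namespace WaiterClient

/-! ### Client's potential strategy -/

section Potential

variable {α : Type*} [DecidableEq α]

/-- The probability that `A` is eventually contained in Client's set if he holds `G` and each element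
of `F` is added to his set with probability `(q + 1)⁻¹`. -/
noncomputable def danger (q : ℕ) (G F A : Finset α) : ℝ :=
  if A ⊆ G ∪ F then (((q : ℝ) + 1)⁻¹) ^ (A \ G).card else 0

lemma danger_nonneg (q : ℕ) (G F A : Finset α) : 0 ≤ danger q G F A := by
  unfold danger; split_ifs <;> positivity

/-- This is the martingale inequality for a uniformly random choice from the offer. A set that
misses the offer keeps its danger. A set that meets it survives only if its unique offered element
is kept, and then gains exactly a factor q + 1. -/
lemma sum_danger_le {q : ℕ} {G F S : Finset α} (A : Finset α) (hGF : Disjoint G F) (hS : S ⊆ F)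
    (hc : S.card = q + 1) :
    ∑ e ∈ S, danger q (insert e G) (F \ S) A ≤ ((q : ℝ) + 1) * danger q G F A := by
  by_cases hAS : Disjoint A S
  · have key : ∀ e ∈ S, danger q (insert e G) (F \ S) A = danger q G F A := by
      intro e he
      have heA : e ∉ A := fun h => Finset.disjoint_left.1 hAS h he
      have h1 : A ⊆ insert e G ∪ F \ S ↔ A ⊆ G ∪ F := by
        constructor
        · intro h x hx
          have := h hx
          have hxe : x ≠ e := fun h => heA (h ▸ hx)
          simp only [Finset.mem_union, Finset.mem_insert, Finset.mem_sdiff] at this ⊢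
          tauto
        · intro h x hx
          have := h hx
          have hxS : x ∉ S := fun h => Finset.disjoint_left.1 hAS hx h
          simp only [Finset.mem_union, Finset.mem_insert, Finset.mem_sdiff] at this ⊢
          tauto
      have h2 : A \ insert e G = A \ G := by
        rw [Finset.sdiff_insert_of_notMem heA]
      unfold danger
      rw [h2]
      simp only [h1]
    rw [Finset.sum_congr rfl key, Finset.sum_const, hc, nsmul_eq_mul]
    push_cast
    exact le_rfl
  · obtain ⟨e₀, heA, heS⟩ := Finset.not_disjoint_iff.1 hAS
    have heG : e₀ ∉ G := fun h => Finset.disjoint_left.1 hGF h (hS heS)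
    -- Keeping any other element hands `e₀` to Waiter, so the danger of `A` drops to 0.
    rw [Finset.sum_eq_single_of_mem e₀ heS]
    · unfold danger
      have hsub : A ⊆ insert e₀ G ∪ F \ S → A ⊆ G ∪ F := by
        intro h x hx
        have := h hx
        simp only [Finset.mem_union, Finset.mem_insert, Finset.mem_sdiff] at this ⊢
        rcases this with (rfl | h) | h
        · exact Or.inr (hS heS)
        · exact Or.inl h
        · exact Or.inr h.1
      split_ifs with h1 h2
      · have : (A \ G).card = (A \ insert e₀ G).card + 1 := by
          have h : A \ insert e₀ G = (A \ G).erase e₀ := by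
            ext x; simp only [Finset.mem_sdiff, Finset.mem_insert, Finset.mem_erase]; tauto
          rw [h, Finset.card_erase_add_one (Finset.mem_sdiff.2 ⟨heA, heG⟩)]
        rw [this, pow_succ]
        have : ((q : ℝ) + 1) ≠ 0 := by positivity
        field_simp
        exact le_rfl
      · exact absurd (hsub h1) h2
      · positivity
      · simp
    · intro e he hne
      unfold danger
      rw [if_neg]
      intro h
      have := h heA
      simp only [Finset.mem_union, Finset.mem_insert, Finset.mem_sdiff] at this
      tauto

/-- The total danger of a family. -/
noncomputable def totalDanger (q : ℕ) (Fam : Multiset (Finset α)) (G F : Finset α) : ℝ :=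
  (Fam.map (danger q G F)).sum

lemma sum_totalDanger_le {q : ℕ} (Fam : Multiset (Finset α)) {G F S : Finset α}
    (hGF : Disjoint G F) (hS : S ⊆ F) (hc : S.card = q + 1) :
    ∑ e ∈ S, totalDanger q Fam (insert e G) (F \ S) ≤ ((q : ℝ) + 1) * totalDanger q Fam G F := by
  unfold totalDanger
  induction Fam using Multiset.induction with
  | empty => simp
  | cons A Fam ih =>
    simp only [Multiset.map_cons, Multiset.sum_cons, Finset.sum_add_distrib, mul_add]
    exact add_le_add (sum_danger_le A hGF hS hc) ih

/-- The strategy of Client that minimises the total danger. -/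
noncomputable def cautious [Nonempty α] (X : Finset α) (q : ℕ) (Fam : Multiset (Finset α)) :
    ClientStrategy α where
  pick h S := if hS : S.Nonempty then
      (Finset.exists_min_image S
        (fun e => totalDanger q Fam (insert e (clientClaims h)) (free X h \ S)) hS).choose
    else Classical.arbitrary α
  pick_mem h S hS := by
    rw [dif_pos hS]
    exact (Finset.exists_min_image S
        (fun e => totalDanger q Fam (insert e (clientClaims h)) (free X h \ S)) hS).choose_spec.1

lemma cautious_min [Nonempty α] (X : Finset α) (q : ℕ) (Fam : Multiset (Finset α))
    (h : History α) (S : Finset α) {e : α} (he : e ∈ S) :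
    totalDanger q Fam (insert ((cautious X q Fam).pick h S) (clientClaims h)) (free X h \ S) ≤
      totalDanger q Fam (insert e (clientClaims h)) (free X h \ S) := by
  have hS : S.Nonempty := ⟨e, he⟩
  simp only [cautious, dif_pos hS]
  exact (Finset.exists_min_image S
        (fun e => totalDanger q Fam (insert e (clientClaims h)) (free X h \ S)) hS).choose_spec.2 e he

lemma disjoint_play {X : Finset α} {q : ℕ} (W : WaiterStrategy X q) (C : ClientStrategy α) (i : ℕ) :
    Disjoint (clientClaims (play W C i)) (free X (play W C i)) := by
  induction i with
  | zero => simp [play, clientClaims]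
  | succ i ih =>
    rw [play]
    split_ifs with h
    · have hne : (W.offer (play W C i)).Nonempty := by
        rw [← Finset.card_pos, W.offer_card _ h]; omega
      simp only [clientClaims, free, Finset.disjoint_insert_left, Finset.mem_sdiff, not_and, not_not]
      exact ⟨fun _ => C.pick_mem _ _ hne, ih.mono_right Finset.sdiff_subset⟩
    · exact ih

lemma totalDanger_play_le [Nonempty α] {X : Finset α} {q : ℕ} (Fam : Multiset (Finset α))
    (W : WaiterStrategy X q) (i : ℕ) :
    totalDanger q Fam (clientClaims (play W (cautious X q Fam) i))
      (free X (play W (cautious X q Fam) i)) ≤ totalDanger q Fam ∅ X := by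
  induction i with
  | zero => exact le_rfl
  | succ i ih =>
    rw [play]
    split_ifs with h
    · refine le_trans ?_ ih
      simp only [clientClaims, free]
      set hist := play W (cautious X q Fam) i with hhist
      have h1 := sum_totalDanger_le Fam (disjoint_play W (cautious X q Fam) i)
        (W.offer_subset _ h) (W.offer_card _ h)
      -- The minimum over the q + 1 choices is at most their average.
      have h2 := Finset.card_nsmul_le_sum (W.offer hist) _ _
        (fun e he => cautious_min X q Fam hist (W.offer hist) he)
      rw [W.offer_card _ h, nsmul_eq_mul] at h2
      have h3 := h2.trans h1
      push_cast at h3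
      exact le_of_mul_le_mul_left h3 (by positivity)
    · exact ih

/-- Client can ensure that he fully claims at most as many sets of a family as would be expected
if he claimed each element with probability `(q + 1)⁻¹`. -/
theorem exists_clientStrategy_countP_le [Nonempty α] (X : Finset α) (q : ℕ)
    (Fam : Multiset (Finset α)) :
    ∃ C : ClientStrategy α, ∀ W : WaiterStrategy X q,
      ((Fam.countP (· ⊆ outcome W C) : ℕ) : ℝ) ≤
        (Fam.map fun A => (((q : ℝ) + 1)⁻¹) ^ A.card).sum := by
  refine ⟨cautious X q Fam, fun W => ?_⟩
  have h1 := totalDanger_play_le Fam W X.card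
  refine le_trans ?_ (h1.trans ?_)
  · change ((Fam.countP (· ⊆ clientClaims (play W (cautious X q Fam) X.card)) : ℕ) : ℝ) ≤ _
    generalize clientClaims (play W (cautious X q Fam) X.card) = G
    generalize free X (play W (cautious X q Fam) X.card) = F
    unfold totalDanger
    induction Fam using Multiset.induction with
    | empty => simp
    | cons A Fam ih =>
      rw [Multiset.countP_cons, Multiset.map_cons, Multiset.sum_cons]
      have : ((if A ⊆ G then 1 else 0 : ℕ) : ℝ) ≤ danger q G F A := by
        split_ifs with hA
        · rw [danger, if_pos (hA.trans Finset.subset_union_left), Finset.sdiff_eq_empty_iff_subset.2 hA]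
          simp
        · simpa using danger_nonneg q G F A
      push_cast at this ⊢
      linarith [ih (totalDanger_play_le Fam W X.card)]
  · refine Multiset.sum_map_le_sum_map _ _ fun A _ => ?_
    unfold danger
    split_ifs
    · simp
    · positivity

end Potential

/-! ### Trees with marked vertices: expectation and count -/

section Trees

/-- The expected number of members of a family in a random set of density `p`. -/
noncomputable def weight {V : Type*} (p : ℝ) (M : Multiset (Finset (Sym2 V))) : ℝ :=
  (M.map fun A => p ^ A.card).sum

lemma weight_add {V : Type*} (p : ℝ) (M N : Multiset (Finset (Sym2 V))) :
    weight p (M + N) = weight p M + weight p N := by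
  simp [weight]

lemma weight_sum {V ι : Type*} (p : ℝ) (s : Finset ι) (f : ι → Multiset (Finset (Sym2 V))) :
    weight p (∑ i ∈ s, f i) = ∑ i ∈ s, weight p (f i) := by
  classical
  induction s using Finset.induction_on with
  | empty => simp [weight]
  | insert i s hi ih => rw [Finset.sum_insert hi, Finset.sum_insert hi, weight_add, ih]

/-- `AvoidingReach G l c w`: some path of `G` from `c` to `w` avoids `l` after its first vertex. -/
inductive AvoidingReach {V : Type*} [DecidableEq V] (G : SimpleGraph V) : Finset V → V → V → Prop
  | refl (l : Finset V) (c : V) : AvoidingReach G l c c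
  | step {l : Finset V} {c v w : V} : G.Adj c v → v ∉ l → AvoidingReach G (insert v l) v w →
      AvoidingReach G l c w

lemma AvoidingReach.anti {V : Type*} [DecidableEq V] {G : SimpleGraph V} {l l' : Finset V} {c w : V}
    (h : AvoidingReach G l' c w) (hl : l ⊆ l') : AvoidingReach G l c w := by
  induction h generalizing l with
  | refl => exact .refl _ _
  | step hadj hv _ ih =>
    exact .step hadj (fun h => hv (hl h)) (ih (Finset.insert_subset_insert _ hl))

variable {V : Type*} [Fintype V] [DecidableEq V]

/-- Edge sets of the form `A` plus a self-avoiding path which starts at `c` and whose other vertices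
(at most `k` of them) avoid the set `l` of vertices seen before, extended further by `N`. -/
def pathExtensions (N : ℕ → Finset V → Finset (Sym2 V) → Multiset (Finset (Sym2 V))) :
    ℕ → Finset V → V → Finset (Sym2 V) → Multiset (Finset (Sym2 V))
  | 0, l, _, A => N 0 l A
  | k + 1, l, c, A => N (k + 1) l A +
      ∑ v ∈ lᶜ, pathExtensions N k (insert v l) v (insert s(c, v) A)

/-- Edge sets which arise from `A`, with vertices in `l`, by attaching `r` self-avoiding paths one
after another, the last vertices of the paths being marked. -/
def treeExtensions : ℕ → ℕ → Finset V → Finset (Sym2 V) → Multiset (Finset (Sym2 V))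
  | 0, _, _, A => {A}
  | r + 1, k, l, A => ∑ u ∈ l, pathExtensions (treeExtensions r) k l u A

/-- A path either stops, at cost `g`, or gains a vertex: at most |V| choices, each with a new edge
of weight p. Hence any supersolution `H` of this recursion bounds the weight, uniformly in the
budget `k`. -/
lemma weight_pathExtensions_le {p μ : ℝ} (hp : 0 ≤ p) (hμ : p * Fintype.card V ≤ μ) {g H : ℕ → ℝ}
    (hH0 : ∀ m, 0 ≤ H m) (hH : ∀ m, g m + μ * H (m + 1) ≤ H m)
    {N : ℕ → Finset V → Finset (Sym2 V) → Multiset (Finset (Sym2 V))}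
    (hN : ∀ k l A, (∀ e ∈ A, ∀ v ∈ e, v ∈ l) → weight p (N k l A) ≤ p ^ A.card * g l.card) :
    ∀ k l c A, c ∈ l → (∀ e ∈ A, ∀ v ∈ e, v ∈ l) →
      weight p (pathExtensions N k l c A) ≤ p ^ A.card * H l.card := by
  have hμ0 : 0 ≤ μ := le_trans (by positivity) hμ
  intro k
  induction k with
  | zero =>
    intro l c A _ hA
    refine (hN 0 l A hA).trans (mul_le_mul_of_nonneg_left ?_ (by positivity))
    have := hH l.card
    have := mul_nonneg hμ0 (hH0 (l.card + 1))
    linarith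
  | succ k ih =>
    intro l c A hc hA
    rw [pathExtensions, weight_add, weight_sum]
    have h1 : ∀ v ∈ lᶜ, weight p (pathExtensions N k (insert v l) v (insert s(c, v) A)) ≤
        p ^ (A.card + 1) * H (l.card + 1) := by
      intro v hv
      rw [Finset.mem_compl] at hv
      have h := ih (insert v l) v (insert s(c, v) A) (Finset.mem_insert_self _ _) (by
        intro e he w hw
        rcases Finset.mem_insert.1 he with rfl | he
        · rcases Sym2.mem_iff.1 hw with rfl | rfl
          · exact Finset.mem_insert_of_mem hc
          · exact Finset.mem_insert_self _ _
        · exact Finset.mem_insert_of_mem (hA e he w hw))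
      rwa [Finset.card_insert_of_notMem hv, Finset.card_insert_of_notMem] at h
      exact fun h => hv (hA _ h v (Sym2.mem_mk_right _ _))
    have h2 := Finset.sum_le_card_nsmul _ _ _ h1
    rw [nsmul_eq_mul] at h2
    have h3 : ((lᶜ).card : ℝ) * (p ^ (A.card + 1) * H (l.card + 1)) ≤
        p ^ A.card * (μ * H (l.card + 1)) := by
      have h4 : ((lᶜ).card : ℝ) ≤ Fintype.card V := by exact_mod_cast Finset.card_le_univ _
      have h5 : p * (lᶜ).card ≤ μ := (mul_le_mul_of_nonneg_left h4 hp).trans hμ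
      calc ((lᶜ).card : ℝ) * (p ^ (A.card + 1) * H (l.card + 1))
          = p ^ A.card * ((p * (lᶜ).card) * H (l.card + 1)) := by ring
        _ ≤ _ := by
          have := hH0 (l.card + 1)
          gcongr
    have h6 := mul_le_mul_of_nonneg_left (hH l.card) (pow_nonneg hp A.card)
    have h7 := hN (k + 1) l A hA
    rw [mul_add] at h6
    linarith

/-- The supersolution inequality for the choice of `H` in `weight_treeExtensions_le`. After division
by X^r, Bernoulli bounds for both powers make the first-order gain 2r/X outweigh the loss (1 -
δ)·2r/X. -/
lemma mul_pow_succ_add_mul_pow_sub_le {δ X : ℝ} {r : ℕ} (hδ : 0 < δ) (hδ1 : δ ≤ 1)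
    (hX : 4 / δ * (r + 1) ≤ X) :
    δ * (X - 4 / δ) ^ r + (1 - δ) * (X + 1) ^ r ≤ X ^ r := by
  have hc : 4 ≤ 4 / δ := by rw [le_div_iff₀ hδ]; linarith
  have hX0 : 0 < X := lt_of_lt_of_le (by positivity) hX
  have hcr : 0 ≤ (4 / δ - 4) * (r + 1) := mul_nonneg (by linarith) (by positivity)
  have hr0 : (0 : ℝ) ≤ r := Nat.cast_nonneg r
  have hX4 : 4 * ((r : ℝ) + 1) ≤ X := by linarith
  obtain ⟨t, ht⟩ : ∃ t, t = 1 / X := ⟨_, rfl⟩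
  have ht0 : 0 < t := by rw [ht]; positivity
  have htX : t * X = 1 := by rw [ht]; field_simp
  obtain ⟨y, hy⟩ : ∃ y, y = 4 / δ * t := ⟨_, rfl⟩
  have hyδ : δ * y = 4 * t := by rw [hy]; field_simp
  have hy0 : 0 < y := by rw [hy]; positivity
  have hry : (r + 1) * y ≤ 1 := by
    rw [← htX, hy]; nlinarith
  have hrt : 4 * (r + 1) * t ≤ 1 := by
    rw [← htX]; nlinarith
  have hy1 : y ≤ 1 := by nlinarith
  have e1 : X - 4 / δ = X * (1 - y) := by rw [hy]; linear_combination (4 / δ) * htX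
  have e2 : X + 1 = X * (1 + t) := by linear_combination -htX
  rw [e1, e2, mul_pow, mul_pow]
  have b1 : (1 - y) ^ r ≤ 1 - r * y / 2 := by
    have h1 : 1 + r * y ≤ (1 + y) ^ r := one_add_mul_le_pow (by linarith) r
    have h2 : (1 - y) ^ r * (1 + y) ^ r ≤ 1 := by
      rw [← mul_pow]; exact pow_le_one₀ (by nlinarith) (by nlinarith)
    have h3 : 0 ≤ (1 - y) ^ r := pow_nonneg (by linarith) r
    have h4 : (1 - y) ^ r * (1 + r * y) ≤ 1 := (mul_le_mul_of_nonneg_left h1 h3).trans h2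
    have hs : 0 ≤ r * y := by positivity
    have hs1 : r * y ≤ 1 := by nlinarith
    have h5 : 1 ≤ (1 - r * y / 2) * (1 + r * y) := by nlinarith
    exact le_of_mul_le_mul_right (h4.trans h5) (by positivity)
  have b2 : (1 + t) ^ r ≤ 1 + 2 * (r * t) := by
    have h1 : 1 + r * (-t) ≤ (1 + -t) ^ r := one_add_mul_le_pow (by nlinarith) r
    have h2 : (1 + t) ^ r * (1 + -t) ^ r ≤ 1 := by
      rw [← mul_pow]; exact pow_le_one₀ (by nlinarith) (by nlinarith)
    have h3 : 0 ≤ (1 + t) ^ r := by positivity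
    have h4 : (1 + t) ^ r * (1 + r * (-t)) ≤ 1 := (mul_le_mul_of_nonneg_left h1 h3).trans h2
    have hs : 0 ≤ r * t := by positivity
    have hs1 : 2 * (r * t) ≤ 1 := by nlinarith
    have h5 : 1 ≤ (1 + 2 * (r * t)) * (1 + r * (-t)) := by nlinarith
    exact le_of_mul_le_mul_right (h4.trans h5) (by nlinarith)
  have hXr : 0 < X ^ r := by positivity
  have main : δ * (1 - y) ^ r + (1 - δ) * (1 + t) ^ r ≤ 1 := by
    have c1 := mul_le_mul_of_nonneg_left b1 hδ.le
    have c2 := mul_le_mul_of_nonneg_left b2 (sub_nonneg.2 hδ1)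
    have c3 : δ * (1 - r * y / 2) + (1 - δ) * (1 + 2 * (r * t)) = 1 - 2 * δ * (r * t) := by
      linear_combination (-(r : ℝ) / 2) * hyδ
    have c4 : 0 ≤ 2 * δ * (r * t) := by positivity
    linarith
  nlinarith

/-- Each new path costs a factor δ⁻¹ for its length and |l| for its starting vertex; the shift 4/δ
per path absorbs the growth of `l` along the paths. -/
lemma weight_treeExtensions_le {p δ : ℝ} (hp : 0 ≤ p) (hδ : 0 < δ) (hδ1 : δ ≤ 1)
    (hpδ : p * Fintype.card V ≤ 1 - δ) (r : ℕ) :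
    ∀ (k : ℕ) (l : Finset V) (A : Finset (Sym2 V)), (∀ e ∈ A, ∀ v ∈ e, v ∈ l) →
      weight p (treeExtensions r k l A) ≤ p ^ A.card * ((δ⁻¹) ^ r * (l.card + 4 / δ * r) ^ r) := by
  induction r with
  | zero => intro k l A _; simp [treeExtensions, weight]
  | succ r ih =>
    intro k l A hA
    have hstep := weight_pathExtensions_le (V := V) hp hpδ
      (g := fun m => (δ⁻¹) ^ r * (m + 4 / δ * r) ^ r)
      (H := fun m => (δ⁻¹) ^ (r + 1) * (m + 4 / δ * (r + 1)) ^ r)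
      (fun m => by positivity)
      (fun m => by
        have hm : (0 : ℝ) ≤ m := Nat.cast_nonneg m
        have h := mul_pow_succ_add_mul_pow_sub_le (X := m + 4 / δ * (r + 1)) (r := r) hδ hδ1
          (by linarith)
        have e1 : (m : ℝ) + 4 / δ * (r + 1) - 4 / δ = m + 4 / δ * r := by ring
        rw [e1] at h
        have h' := mul_le_mul_of_nonneg_left h (pow_nonneg (inv_nonneg.2 hδ.le) (r + 1))
        refine le_trans (le_of_eq ?_) h'
        push_cast
        rw [pow_succ]
        field_simp
        ring)
      (fun k l A hA => ih k l A hA)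
    rw [treeExtensions, weight_sum]
    have h1 := Finset.sum_le_card_nsmul l _ _ (fun u hu => hstep k l u A hu hA)
    rw [nsmul_eq_mul] at h1
    refine h1.trans ?_
    have h2 : (l.card : ℝ) ≤ l.card + 4 / δ * (r + 1) := by
      have : 0 ≤ 4 / δ * ((r : ℝ) + 1) := by positivity
      linarith
    calc (l.card : ℝ) * (p ^ A.card * ((δ⁻¹) ^ (r + 1) * (l.card + 4 / δ * (r + 1)) ^ r))
        ≤ (l.card + 4 / δ * (r + 1)) *
          (p ^ A.card * ((δ⁻¹) ^ (r + 1) * (l.card + 4 / δ * (r + 1)) ^ r)) := by gcongr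
      _ = _ := by push_cast; ring

/-- Enlarge `l` by the far end of an edge leaving it. A path found from the enlarged set starts in
`l` already or can be prolonged backwards by that edge. -/
lemma exists_avoidingReach {G : SimpleGraph V} {w : V} (k : ℕ) :
    ∀ l : Finset V, Fintype.card V ≤ k + l.card → (∃ u ∈ l, G.Reachable u w) →
      ∃ u ∈ l, AvoidingReach G l u w := by
  induction k with
  | zero =>
    intro l hl _
    have : l = Finset.univ := Finset.eq_univ_of_card l (le_antisymm (Finset.card_le_univ l) (by omega))
    exact ⟨w, this ▸ Finset.mem_univ w, .refl _ _⟩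
  | succ k ih =>
    rintro l hl ⟨u, hu, ⟨p⟩⟩
    by_cases hw : w ∈ l
    · exact ⟨w, hw, .refl _ _⟩
    obtain ⟨d, _, hd1, hd2⟩ := p.exists_boundary_dart (l : Set V) hu hw
    have hd2' : d.snd ∉ l := hd2
    obtain ⟨u', hu', h⟩ := ih (insert d.snd l)
      (by rw [Finset.card_insert_of_notMem hd2']; omega)
      ⟨u, Finset.mem_insert_of_mem hu, ⟨p⟩⟩
    rcases Finset.mem_insert.1 hu' with rfl | hu'
    · exact ⟨d.fst, hd1, .step d.adj hd2' h⟩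
    · exact ⟨u', hu', h.anti (Finset.subset_insert _ _)⟩

lemma countP_sum {ι β : Type*} (P : β → Prop) [DecidablePred P] (s : Finset ι)
    (f : ι → Multiset β) : (∑ i ∈ s, f i).countP P = ∑ i ∈ s, (f i).countP P := by
  classical
  induction s using Finset.induction_on with
  | empty => simp
  | insert i s hi ih => rw [Finset.sum_insert hi, Finset.sum_insert hi, Multiset.countP_add, ih]

-- Each endpoint of a path inside Client's graph contributes at least `B` claimed sets. The
-- condition |V| ≤ k + |l| persists along a path, so the budget never runs out before the vertices
-- do.
open Classical in
lemma mul_card_le_countP_pathExtensions {E : Finset (Sym2 V)} {B : ℕ} {K : Set V}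
    {N : ℕ → Finset V → Finset (Sym2 V) → Multiset (Finset (Sym2 V))}
    (hK : ∀ u v, (SimpleGraph.fromEdgeSet (E : Set (Sym2 V))).Adj u v → u ∈ K → v ∈ K)
    (hN : ∀ (k : ℕ) (l : Finset V) (A : Finset (Sym2 V)), l.Nonempty → (l : Set V) ⊆ K → A ⊆ E →
      Fintype.card V ≤ k + l.card → B ≤ (N k l A).countP (· ⊆ E)) :
    ∀ (k : ℕ) (l : Finset V) (c : V) (A : Finset (Sym2 V)), c ∈ l → (l : Set V) ⊆ K → A ⊆ E →
      Fintype.card V ≤ k + l.card →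
      B * (Finset.univ.filter (AvoidingReach (SimpleGraph.fromEdgeSet (E : Set (Sym2 V))) l c)).card
        ≤ (pathExtensions N k l c A).countP (· ⊆ E) := by
  set G := SimpleGraph.fromEdgeSet (E : Set (Sym2 V)) with hG
  intro k
  induction k with
  | zero =>
    intro l c A hc hl hA hk
    have hlu : l = Finset.univ := Finset.eq_univ_of_card l (le_antisymm (Finset.card_le_univ l) (by omega))
    have : (Finset.univ.filter (AvoidingReach G l c)) ⊆ {c} := by
      intro w hw
      rcases (Finset.mem_filter.1 hw).2 with _ | ⟨_, hv, _⟩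
      · simp
      · exact absurd (hlu ▸ Finset.mem_univ _) hv
    have h1 := Finset.card_le_card this
    rw [Finset.card_singleton] at h1
    calc _ ≤ B * 1 := Nat.mul_le_mul_left _ h1
      _ ≤ _ := by rw [mul_one]; exact hN 0 l A ⟨c, hc⟩ hl hA hk
  | succ k ih =>
    intro l c A hc hl hA hk
    rw [pathExtensions, Multiset.countP_add, countP_sum]
    -- Sort the reachable endpoints by the second vertex of a path.
    have hsub : (Finset.univ.filter (AvoidingReach G l c)) ⊆
        {c} ∪ (lᶜ.filter (G.Adj c)).biUnion
          (fun v => Finset.univ.filter (AvoidingReach G (insert v l) v)) := by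
      intro w hw
      rcases (Finset.mem_filter.1 hw).2 with _ | ⟨hadj, hv, h⟩
      · simp
      · exact Finset.mem_union_right _ (Finset.mem_biUnion.2
          ⟨_, Finset.mem_filter.2 ⟨Finset.mem_compl.2 hv, hadj⟩,
            Finset.mem_filter.2 ⟨Finset.mem_univ _, h⟩⟩)
    have h1 := (Finset.card_le_card hsub).trans
      ((Finset.card_union_le _ _).trans (Nat.add_le_add_left Finset.card_biUnion_le _))
    rw [Finset.card_singleton] at h1
    have h2 : ∀ v ∈ lᶜ.filter (G.Adj c),
        B * (Finset.univ.filter (AvoidingReach G (insert v l) v)).card ≤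
          (pathExtensions N k (insert v l) v (insert s(c, v) A)).countP (· ⊆ E) := by
      intro v hv
      obtain ⟨hvl, hadj⟩ := Finset.mem_filter.1 hv
      rw [Finset.mem_compl] at hvl
      refine ih _ _ _ (Finset.mem_insert_self _ _) ?_ ?_ ?_
      · rw [Finset.coe_insert]
        exact Set.insert_subset (hK c v hadj (hl hc)) hl
      · refine Finset.insert_subset ?_ hA
        have := ((SimpleGraph.fromEdgeSet_adj _).1 hadj).1
        exact_mod_cast this
      · rw [Finset.card_insert_of_notMem hvl]; omega
    calc _ ≤ B * (1 + ∑ v ∈ lᶜ.filter (G.Adj c),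
            (Finset.univ.filter (AvoidingReach G (insert v l) v)).card) := Nat.mul_le_mul_left _ h1
      _ = B + ∑ v ∈ lᶜ.filter (G.Adj c),
            B * (Finset.univ.filter (AvoidingReach G (insert v l) v)).card := by
          rw [mul_add, mul_one, Finset.mul_sum]
      _ ≤ _ := Nat.add_le_add (hN _ l A ⟨c, hc⟩ hl hA hk) ((Finset.sum_le_sum h2).trans
          (Finset.sum_le_sum_of_subset (Finset.filter_subset _ _)))

lemma pow_le_countP_treeExtensions {E : Finset (Sym2 V)}
    (K : (SimpleGraph.fromEdgeSet (E : Set (Sym2 V))).ConnectedComponent) (r : ℕ) :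
    ∀ (k : ℕ) (l : Finset V) (A : Finset (Sym2 V)), l.Nonempty → (l : Set V) ⊆ K.supp → A ⊆ E →
      Fintype.card V ≤ k + l.card →
      K.supp.ncard ^ r ≤ (treeExtensions r k l A).countP (· ⊆ E) := by
  classical
  induction r with
  | zero =>
    intro k l A _ _ hA _
    simp [treeExtensions, hA, Multiset.countP_eq_card_filter, Multiset.filter_singleton]
  | succ r ih =>
    intro k l A hne hl hA hk
    rw [treeExtensions, countP_sum]
    have h1 := Finset.sum_le_sum fun u (hu : u ∈ l) => mul_card_le_countP_pathExtensions
      (fun u v huv hu => (K.mem_supp_congr_adj huv).1 hu) ih k l u A hu hl hA hk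
    refine le_trans ?_ h1
    rw [← Finset.mul_sum, pow_succ]
    -- The endpoints reached from all `u ∈ l` together cover the component, which gives the new
    -- factor.
    refine Nat.mul_le_mul_left _ (le_trans ?_ Finset.card_biUnion_le)
    rw [← Set.ncard_coe_finset]
    refine Set.ncard_le_ncard ?_ (Finset.finite_toSet _)
    intro w hw
    obtain ⟨u, hu⟩ := hne
    have hreach := SimpleGraph.ConnectedComponent.exact
      (((SimpleGraph.ConnectedComponent.mem_supp_iff _ _).1 (hl hu)).trans
      ((SimpleGraph.ConnectedComponent.mem_supp_iff _ _).1 hw).symm)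
    obtain ⟨u', hu', h⟩ := exists_avoidingReach k l hk ⟨u, hu, hreach⟩
    simp only [Finset.coe_biUnion, Set.mem_iUnion]
    exact ⟨u', hu', by simpa using h⟩

end Trees

/-! ### Client's bound on the largest component -/

lemma exists_supp_ncard_eq_largestComponentOrder {n : ℕ} (hn : 0 < n) (G : SimpleGraph (Fin n)) :
    ∃ K : G.ConnectedComponent, K.supp.ncard = largestComponentOrder G := by
  have : Nonempty G.ConnectedComponent := ⟨G.connectedComponentMk ⟨0, hn⟩⟩
  exact exists_eq_ciSup_of_finite

/-- Client can keep all components small if `q` exceeds `n` by a constant factor. -/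
theorem exists_clientStrategy_largestComponentOrder_pow_le {n : ℕ} (hn : 0 < n) (q r : ℕ) {δ : ℝ}
    (hδ : 0 < δ) (hδ1 : δ ≤ 1) (hq : n ≤ (1 - δ) * (q + 1)) :
    ∃ C : ClientStrategy (Sym2 (Fin n)), ∀ W : WaiterStrategy (completeEdges n) q,
      (largestComponentOrder (clientGraph W C) : ℝ) ^ r ≤
        n * ((δ⁻¹) ^ r * (1 + 4 / δ * r) ^ r) := by
  have : Nonempty (Sym2 (Fin n)) := ⟨s(⟨0, hn⟩, ⟨0, hn⟩)⟩
  obtain ⟨C, hC⟩ := exists_clientStrategy_countP_le (completeEdges n) q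
    (∑ v : Fin n, treeExtensions r n {v} ∅)
  refine ⟨C, fun W => ?_⟩
  obtain ⟨K, hK⟩ := exists_supp_ncard_eq_largestComponentOrder hn (clientGraph W C)
  rw [← hK]
  obtain ⟨v, hv⟩ := K.nonempty_supp
  have h1 : K.supp.ncard ^ r ≤
      (∑ v : Fin n, treeExtensions r n {v} ∅).countP (· ⊆ outcome W C) := by
    rw [countP_sum]
    refine (pow_le_countP_treeExtensions K r n {v} ∅ (Finset.singleton_nonempty v)
      (by rw [Finset.coe_singleton]; exact Set.singleton_subset_iff.2 hv) (Finset.empty_subset _) (by simp)).trans ?_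
    exact Finset.single_le_sum
      (f := fun v => (treeExtensions r n {v} ∅).countP (· ⊆ outcome W C))
      (fun _ _ => Nat.zero_le _) (Finset.mem_univ v)
  have h2 := hC W
  have hq0 : (0 : ℝ) < q + 1 := by positivity
  have h3 : ∀ v ∈ (Finset.univ : Finset (Fin n)),
      weight ((q : ℝ) + 1)⁻¹ (treeExtensions r n {v} ∅) ≤ (δ⁻¹) ^ r * (1 + 4 / δ * r) ^ r := by
    intro v _
    have := weight_treeExtensions_le (V := Fin n) (p := ((q : ℝ) + 1)⁻¹) (by positivity) hδ hδ1
      (by rw [Fintype.card_fin, inv_mul_le_iff₀ hq0]; linarith) r n {v} ∅ (by simp)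
    simpa using this
  have h4 := Finset.sum_le_card_nsmul _ _ _ h3
  rw [← weight_sum] at h4
  simp only [Finset.card_univ, Fintype.card_fin, nsmul_eq_mul] at h4
  refine le_trans ?_ (h2.trans h4)
  exact_mod_cast h1

theorem exists_clientStrategy_largestComponentOrder_le {n : ℕ} (hn : 3 ≤ n) {ε : ℝ} (hε : 0 < ε)
    (hε1 : ε < 1) {q : ℕ} (hq : (1 + ε) * n ≤ q) :
    ∃ C : ClientStrategy (Sym2 (Fin n)), ∀ W : WaiterStrategy (completeEdges n) q,
      (largestComponentOrder (clientGraph W C) : ℝ) ≤ 120 * (ε ^ 2)⁻¹ * Real.log n := by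
  have hn3 : (3 : ℝ) ≤ n := by exact_mod_cast hn
  have hlog : 1 ≤ Real.log n := by
    rw [Real.le_log_iff_exp_le (by linarith)]
    exact Real.exp_one_lt_three.le.trans hn3
  set r := ⌈Real.log n⌉₊ with hr
  have hr1 : Real.log n ≤ r := Nat.le_ceil _
  have hr2 : (r : ℝ) < Real.log n + 1 := Nat.ceil_lt_add_one (by linarith)
  have hr0 : r ≠ 0 := by
    intro h; rw [h] at hr1; norm_num at hr1; linarith
  obtain ⟨C, hC⟩ := exists_clientStrategy_largestComponentOrder_pow_le (n := n) (by omega) q r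
    -- Here (1 - ε/2)(1 + ε) = 1 + ε(1 - ε)/2 ≥ 1.
    (δ := ε / 2) (by positivity) (by linarith) (by
      have h1 : (1 - ε / 2) * ((1 + ε) * n) ≤ (1 - ε / 2) * q :=
        mul_le_mul_of_nonneg_left hq (by linarith)
      have h2 : 0 ≤ ε * (1 - ε) * n := by
        have := sub_pos.2 hε1
        positivity
      linarith)
  refine ⟨C, fun W => ?_⟩
  have h1 := hC W
  have h2 : (n : ℝ) ≤ (3 : ℝ) ^ r := by
    rw [← Real.log_le_log_iff (by linarith) (by positivity), Real.log_pow]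
    have : 1 ≤ Real.log 3 := by
      rw [Real.le_log_iff_exp_le (by norm_num)]
      exact Real.exp_one_lt_three.le
    nlinarith
  have h3 : (largestComponentOrder (clientGraph W C) : ℝ) ^ r ≤
      (3 * ((ε / 2)⁻¹ * (1 + 4 / (ε / 2) * r))) ^ r := by
    rw [mul_pow, mul_pow]
    exact h1.trans (mul_le_mul_of_nonneg_right h2 (by positivity))
  have h4 := le_of_pow_le_pow_left₀ hr0 (by positivity) h3
  refine h4.trans ?_
  -- Since r < ln n + 1 and ln n ≥ 1, the numerator is at most 102 ln n, within the constant 120.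
  have h5 : 3 * ((ε / 2)⁻¹ * (1 + 4 / (ε / 2) * r)) = (6 * ε + 48 * r) * (ε ^ 2)⁻¹ := by
    field_simp
    ring
  rw [h5, mul_assoc, mul_comm (ε ^ 2)⁻¹, ← mul_assoc]
  refine mul_le_mul_of_nonneg_right ?_ (by positivity)
  linarith

end WaiterClient

namespace WaiterClient

/-! ### Waiter strategies from invariants -/

section Strategy

variable {α : Type*} [DecidableEq α]

/-- If a property of the position can be preserved by Waiter in the first `m` rounds, then Waiter
has a strategy which preserves it for `m` rounds. -/
theorem exists_waiterStrategy {X : Finset α} {q m : ℕ} (P : ℕ → Finset α → Finset α → Prop)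
    (h0 : P 0 X ∅)
    (hstep : ∀ i F G, i < m → P i F G →
      ∃ S ⊆ F, S.card = q + 1 ∧ ∀ e ∈ S, P (i + 1) (F \ S) (insert e G))
    (hm : m ≤ X.card) :
    ∃ W : WaiterStrategy X q, ∀ C : ClientStrategy α, ∃ F G, P m F G ∧ G ⊆ outcome W C := by
  classical
  have hex : ∀ h : History α, ∃ S : Finset α, q + 1 ≤ (free X h).card →
      (S ⊆ free X h ∧ S.card = q + 1) ∧
      (h.length < m → P h.length (free X h) (clientClaims h) →
        ∀ e ∈ S, P (h.length + 1) (free X h \ S) (insert e (clientClaims h))) := by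
    intro h
    by_cases hc : q + 1 ≤ (free X h).card
    · by_cases hP : h.length < m ∧ P h.length (free X h) (clientClaims h)
      · obtain ⟨S, hS, hSc, hSP⟩ := hstep _ _ _ hP.1 hP.2
        exact ⟨S, fun _ => ⟨⟨hS, hSc⟩, fun _ _ => hSP⟩⟩
      · obtain ⟨S, hS, hSc⟩ := Finset.exists_subset_card_eq hc
        exact ⟨S, fun _ => ⟨⟨hS, hSc⟩, fun h1 h2 => absurd ⟨h1, h2⟩ hP⟩⟩
    · exact ⟨∅, fun h => absurd h hc⟩
  choose f hf using hex
  let W : WaiterStrategy X q := ⟨f, fun h hc => (hf h hc).1.1, fun h hc => (hf h hc).1.2⟩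
  refine ⟨W, fun C => ?_⟩
  have key : ∀ i ≤ m, (play W C i).length = i ∧
      P i (free X (play W C i)) (clientClaims (play W C i)) := by
    intro i
    induction i with
    | zero => exact fun _ => ⟨rfl, h0⟩
    | succ i ih =>
      intro hi
      obtain ⟨hlen, hP⟩ := ih (by omega)
      have hc : q + 1 ≤ (free X (play W C i)).card := by
        obtain ⟨S, hS, hSc, _⟩ := hstep _ _ _ (by omega) hP
        exact hSc ▸ Finset.card_le_card hS
      have hne : (W.offer (play W C i)).Nonempty := by
        rw [← Finset.card_pos, W.offer_card _ hc]; omega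
      rw [play, if_pos hc]
      refine ⟨by simp [hlen], ?_⟩
      have := (hf (play W C i) hc).2 (by omega) (by rw [hlen]; exact hP) _
        (C.pick_mem (play W C i) (W.offer (play W C i)) hne)
      rw [hlen] at this
      exact this
  have hmono : ∀ i j, i ≤ j → clientClaims (play W C i) ⊆ clientClaims (play W C j) := by
    intro i j hij
    induction hij with
    | refl => exact subset_rfl
    | step _ ih =>
      refine ih.trans ?_
      rw [play]
      split_ifs
      · exact Finset.subset_insert _ _
      · exact subset_rfl
  exact ⟨_, _, (key m le_rfl).2, hmono _ _ hm⟩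

end Strategy

/-- Turns a splitting of the multiset of free degrees into an actual selection of vertices. -/
lemma exists_subset_map_eq {α β : Type*} [DecidableEq α] (d : α → β) (A B : Multiset β) :
    ∀ s : Finset α, s.val.map d = A + B →
      ∃ O ⊆ s, O.val.map d = A ∧ (s \ O).val.map d = B := by
  induction A using Multiset.induction with
  | empty => intro s h; exact ⟨∅, Finset.empty_subset _, rfl, by simpa using h⟩
  | cons b A ih =>
    intro s h
    rw [Multiset.cons_add] at h
    obtain ⟨x, hx, hd, hmap⟩ := (Multiset.map_eq_cons d s.val (A + B) b).2 h
    rw [← Finset.erase_val] at hmap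
    obtain ⟨O, hO, h1, h2⟩ := ih _ hmap
    have hxO : x ∉ O := fun h => Finset.notMem_erase x s (hO h)
    refine ⟨insert x O, Finset.insert_subset hx (hO.trans (Finset.erase_subset _ _)), ?_, ?_⟩
    · rw [Finset.insert_val_of_notMem hxO, Multiset.map_cons, h1, hd]
    · rw [Finset.sdiff_insert, ← Finset.erase_sdiff_comm]
      exact h2

/-! ### One round of growing a component -/

section Growing

variable {V : Type*} [DecidableEq V]

/-- The vertices of `C` which are joined to `u` by an element of `F`. -/
def freeNeighbors (F : Finset (Sym2 V)) (C : Finset V) (u : V) : Finset V :=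
  C.filter (fun c => s(u, c) ∈ F)

/-- Client's graph `G` is connected on `C`, and no edge outside `C` has been offered: they all
belong to the set `F` of free edges. -/
structure IsGrowing (C : Finset V) (F G : Finset (Sym2 V)) : Prop where
  reachable : ∀ u ∈ C, ∀ v ∈ C, (SimpleGraph.fromEdgeSet (G : Set (Sym2 V))).Reachable u v
  free_of_notMem : ∀ u ∉ C, ∀ v ∉ C, u ≠ v → s(u, v) ∈ F

/-- The edges between `u ∈ O` and `T u`. -/
def starEdges (O : Finset V) (T : V → Finset V) : Finset (Sym2 V) :=
  O.biUnion fun u => (T u).image fun c => s(u, c)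

lemma mem_starEdges {O : Finset V} {T : V → Finset V} {e : Sym2 V} :
    e ∈ starEdges O T ↔ ∃ u ∈ O, ∃ c ∈ T u, s(u, c) = e := by
  simp [starEdges]

lemma mk_mem_starEdges {O C : Finset V} {T : V → Finset V}
    (hT : ∀ u ∈ O, T u ⊆ C) {v c : V} (hv : v ∉ C) :
    s(v, c) ∈ starEdges O T ↔ v ∈ O ∧ c ∈ T v := by
  rw [mem_starEdges]
  constructor
  · rintro ⟨u, hu, c', hc', h⟩
    rcases Sym2.eq_iff.1 h with ⟨rfl, rfl⟩ | ⟨rfl, rfl⟩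
    · exact ⟨hu, hc'⟩
    · exact absurd (hT _ hu hc') hv
  · rintro ⟨hv, hc⟩
    exact ⟨v, hv, c, hc, rfl⟩

lemma card_starEdges {O C : Finset V} {T : V → Finset V} (hO : ∀ u ∈ O, u ∉ C)
    (hT : ∀ u ∈ O, T u ⊆ C) : (starEdges O T).card = ∑ u ∈ O, (T u).card := by
  rw [starEdges, Finset.card_biUnion]
  · refine Finset.sum_congr rfl fun u _ => Finset.card_image_of_injective _ fun c c' h => ?_
    exact Sym2.congr_right.1 h
  · intro u hu v hv huv
    refine Finset.disjoint_left.2 fun e h1 h2 => ?_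
    obtain ⟨c, hc, rfl⟩ := Finset.mem_image.1 h1
    obtain ⟨c', hc', h⟩ := Finset.mem_image.1 h2
    rcases Sym2.eq_iff.1 h with ⟨rfl, _⟩ | ⟨rfl, rfl⟩
    · exact huv rfl
    · exact hO _ hv (hT _ hu hc)

/-- The kept edge ties `u` to `C`, and every offered edge has an end in `C`, so edges between outer
vertices remain free. -/
lemma IsGrowing.insert {C : Finset V} {F G : Finset (Sym2 V)} (h : IsGrowing C F G)
    {O : Finset V} {T : V → Finset V} (hO : ∀ u ∈ O, u ∉ C) (hT : ∀ u ∈ O, T u ⊆ C)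
    {u c : V} (hu : u ∈ O) (hc : c ∈ T u) :
    IsGrowing (insert u C) (F \ starEdges O T) (insert s(u, c) G) := by
  have huC := hO u hu
  have hcC := hT u hu hc
  have hmono : SimpleGraph.fromEdgeSet (G : Set (Sym2 V)) ≤
      SimpleGraph.fromEdgeSet ((Insert.insert s(u, c) G : Finset (Sym2 V)) : Set (Sym2 V)) :=
    SimpleGraph.fromEdgeSet_mono (by simp)
  have hadj : (SimpleGraph.fromEdgeSet
      ((Insert.insert s(u, c) G : Finset (Sym2 V)) : Set (Sym2 V))).Adj u c := by
    rw [SimpleGraph.fromEdgeSet_adj]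
    exact ⟨by simp, fun h => huC (h ▸ hcC)⟩
  refine ⟨?_, ?_⟩
  · have key : ∀ v ∈ Insert.insert u C, (SimpleGraph.fromEdgeSet
        ((Insert.insert s(u, c) G : Finset (Sym2 V)) : Set (Sym2 V))).Reachable c v := by
      intro v hv
      rcases Finset.mem_insert.1 hv with rfl | hv
      · exact hadj.symm.reachable
      · exact (h.reachable c hcC v hv).mono hmono
    exact fun v hv w hw => (key v hv).symm.trans (key w hw)
  · intro v hv w hw hvw
    rw [Finset.mem_insert, not_or] at hv hw
    refine Finset.mem_sdiff.2 ⟨h.free_of_notMem v hv.2 w hw.2 hvw, fun hmem => ?_⟩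
    obtain ⟨h1, h2⟩ := (mk_mem_starEdges hT hv.2).1 hmem
    exact hw.2 (hT _ h1 h2)

variable [Fintype V]

/-- The numbers of free edges to `C` of the vertices outside `C`. -/
def freeDegrees (F : Finset (Sym2 V)) (C : Finset V) : Multiset ℕ :=
  (Cᶜ).val.map fun u => (freeNeighbors F C u).card

/-- Offering all the free edges between `C` and some outer vertices: one of these vertices joins
`C`, and each of the others keeps only its edge to the new vertex. -/
lemma IsGrowing.exists_offer {C : Finset V} {F G : Finset (Sym2 V)} (h : IsGrowing C F G)
    {A B : Multiset ℕ} (hAB : freeDegrees F C = A + B) :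
    ∃ S ⊆ F, S.card = A.sum ∧ ∀ e ∈ S, ∃ C', C'.card = C.card + 1 ∧
      IsGrowing C' (F \ S) (Insert.insert e G) ∧
      freeDegrees (F \ S) C' =
        Multiset.replicate (Multiset.card A - 1) 1 + B.map (· + 1) := by
  obtain ⟨O, hOC, hOA, hOB⟩ := exists_subset_map_eq _ A B _ hAB
  have hO : ∀ u ∈ O, u ∉ C := fun u hu => Finset.mem_compl.1 (hOC hu)
  have hT : ∀ u ∈ O, freeNeighbors F C u ⊆ C := fun u _ => Finset.filter_subset _ _
  refine ⟨starEdges O (freeNeighbors F C), ?_, ?_, ?_⟩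
  · intro e he
    obtain ⟨u, _, c, hc, rfl⟩ := mem_starEdges.1 he
    exact (Finset.mem_filter.1 hc).2
  · rw [card_starEdges hO hT, ← hOA]; rfl
  · intro e he
    obtain ⟨u, hu, c, hc, rfl⟩ := mem_starEdges.1 he
    refine ⟨Insert.insert u C, Finset.card_insert_of_notMem (hO u hu), h.insert hO hT hu hc, ?_⟩
    have hcompl : (Insert.insert u C)ᶜ = (O.erase u).disjUnion (Cᶜ \ O)
        (Finset.disjoint_left.2 fun x hx hx' =>
          (Finset.mem_sdiff.1 hx').2 (Finset.mem_of_mem_erase hx)) := by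
      ext x
      have h1 := hO x
      have h2 : x = u → x ∈ O := fun h => h ▸ hu
      simp only [Finset.mem_compl, Finset.mem_insert, Finset.mem_disjUnion, Finset.mem_erase,
        Finset.mem_sdiff]
      tauto
    have hfu : ∀ v, v ∉ C → v ≠ u → s(v, u) ∈ F \ starEdges O (freeNeighbors F C) := by
      intro v hv hvu
      refine Finset.mem_sdiff.2 ⟨h.free_of_notMem v hv u (hO u hu) hvu, fun hmem => ?_⟩
      obtain ⟨h1, h2⟩ := (mk_mem_starEdges hT hv).1 hmem
      exact hO u hu (hT v h1 h2)
    have hmem : ∀ v, v ∉ C → ∀ c ∈ C, (s(v, c) ∈ F \ starEdges O (freeNeighbors F C) ↔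
        s(v, c) ∈ F ∧ v ∉ O) := by
      intro v hv c hc
      rw [Finset.mem_sdiff, mk_mem_starEdges hT hv, freeNeighbors, Finset.mem_filter]
      tauto
    rw [freeDegrees, hcompl, Finset.disjUnion_val, Multiset.map_add]
    congr 1
    · rw [← hOA, Multiset.card_map, ← Finset.card_def, ← Finset.card_erase_of_mem hu,
        Finset.card_def, ← Multiset.map_const']
      refine Multiset.map_congr rfl fun v hv => ?_
      have hv' : v ∈ O.erase u := hv
      obtain ⟨hvu, hvO⟩ := Finset.mem_erase.1 hv'
      rw [Finset.card_eq_one]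
      refine ⟨u, ?_⟩
      ext c
      simp only [freeNeighbors, Finset.mem_filter, Finset.mem_insert, Finset.mem_singleton]
      constructor
      · rintro ⟨rfl | hc, hcF⟩
        · rfl
        · exact absurd hvO ((hmem v (hO v hvO) c hc).1 hcF).2
      · rintro rfl
        exact ⟨Or.inl rfl, hfu v (hO v hvO) hvu⟩
    · rw [← hOB, Multiset.map_map]
      refine Multiset.map_congr rfl fun v hv => ?_
      have hv' : v ∈ Cᶜ \ O := hv
      obtain ⟨hvC, hvO⟩ := Finset.mem_sdiff.1 hv'
      rw [Finset.mem_compl] at hvC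
      have hvu : v ≠ u := fun h => hvO (h ▸ hu)
      rw [Function.comp_apply, ← Finset.card_insert_of_notMem
        (fun h => hO u hu ((Finset.mem_filter.1 h).1) : u ∉ freeNeighbors F C v)]
      congr 1
      ext c
      simp only [freeNeighbors, Finset.mem_filter, Finset.mem_insert]
      constructor
      · rintro ⟨rfl | hc, hcF⟩
        · exact Or.inl rfl
        · exact Or.inr ⟨hc, ((hmem v hvC c hc).1 hcF).1⟩
      · rintro (rfl | ⟨hc, hcF⟩)
        · exact ⟨Or.inl rfl, hfu v hvC hvu⟩
        · exact ⟨Or.inr hc, (hmem v hvC c hc).2 ⟨hcF, hvO⟩⟩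

/-- Offering some of the free edges between `C` and one outer vertex, which has to join `C`. -/
lemma IsGrowing.exists_offer_one {C : Finset V} {F G : Finset (Sym2 V)} (h : IsGrowing C F G)
    {a : ℕ} (hC : C.card < Fintype.card V) (hd : ∀ d ∈ freeDegrees F C, a ≤ d) :
    ∃ S ⊆ F, S.card = a ∧ ∀ e ∈ S, ∃ C', C'.card = C.card + 1 ∧
      IsGrowing C' (F \ S) (Insert.insert e G) ∧ ∀ d ∈ freeDegrees (F \ S) C', a ≤ d := by
  have hd' : ∀ v ∉ C, a ≤ (freeNeighbors F C v).card := fun v hv =>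
    hd _ (Multiset.mem_map_of_mem _ (Finset.mem_compl.2 hv : v ∈ Cᶜ))
  obtain ⟨u, hu⟩ : ∃ u, u ∉ C := by
    by_contra! hall
    rw [Finset.eq_univ_iff_forall.2 hall, Finset.card_univ] at hC
    exact lt_irrefl _ hC
  obtain ⟨T, hTF, hTa⟩ := Finset.exists_subset_card_eq (hd' u hu)
  have hO : ∀ v ∈ ({u} : Finset V), v ∉ C := fun v hv => Finset.mem_singleton.1 hv ▸ hu
  have hT : ∀ v ∈ ({u} : Finset V), (fun _ => T) v ⊆ C :=
    fun _ _ => hTF.trans (Finset.filter_subset _ _)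
  refine ⟨starEdges {u} fun _ => T, ?_, ?_, ?_⟩
  · intro e he
    obtain ⟨v, hv, c, hc, rfl⟩ := mem_starEdges.1 he
    rw [Finset.mem_singleton.1 hv]
    exact (Finset.mem_filter.1 (hTF hc)).2
  · rw [card_starEdges hO hT, Finset.sum_singleton, hTa]
  · intro e he
    obtain ⟨v, hv, c, hc, rfl⟩ := mem_starEdges.1 he
    obtain rfl := Finset.mem_singleton.1 hv
    refine ⟨Insert.insert v C, Finset.card_insert_of_notMem hu, h.insert hO hT hv hc, ?_⟩
    intro d hmem
    obtain ⟨w, hw, rfl⟩ := Multiset.mem_map.1 hmem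
    have hw' : w ∈ (Insert.insert v C)ᶜ := hw
    rw [Finset.mem_compl, Finset.mem_insert, not_or] at hw'
    refine (hd' w hw'.2).trans (Finset.card_le_card fun c' hc' => ?_)
    obtain ⟨h1, h2⟩ := Finset.mem_filter.1 hc'
    refine Finset.mem_filter.2 ⟨Finset.mem_insert_of_mem h1, Finset.mem_sdiff.2 ⟨h2, fun h3 => ?_⟩⟩
    exact hw'.1 (Finset.mem_singleton.1 ((mk_mem_starEdges hT hw'.2).1 h3).1)

end Growing

/-! ### The schedule of free degrees -/

/-- The multiset `{s, s + 1, …, s + t - 1}`. -/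
def ladder (s t : ℕ) : Multiset ℕ := (Multiset.range t).map (· + s)

lemma ladder_zero (s : ℕ) : ladder s 0 = 0 := rfl

lemma ladder_succ (s t : ℕ) : ladder s (t + 1) = (t + s) ::ₘ ladder s t := by
  simp [ladder, Multiset.range_succ]

lemma ladder_succ' (s t : ℕ) : ladder s (t + 1) = s ::ₘ ladder (s + 1) t := by
  induction t with
  | zero => simp [ladder]
  | succ t ih =>
    rw [ladder_succ, ih, ladder_succ, Multiset.cons_swap, add_right_comm, add_assoc]

lemma map_ladder (s t : ℕ) : (ladder s t).map (· + 1) = ladder (s + 1) t := by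
  simp [ladder, Multiset.map_map, add_assoc]

/-- The free degrees that Waiter maintains while growing a component in Client's graph from one
vertex to `2 * b` vertices, `k` being the current order. -/
def profile (a b x k : ℕ) : Multiset ℕ :=
  if k ≤ b then Multiset.replicate (a - k) 1 + Multiset.replicate (b - k) k + ladder 1 k +
    Multiset.replicate x k
  else Multiset.replicate (a - b) 1 + ladder (k - b + 1) (2 * b - k) + Multiset.replicate x k

/-- Take the top of the ladder, which is min(k, b), together with a - min(k, b) ones. For k < b, one
of the resulting ones becomes the new bottom of the ladder and one of the b - k reserve vertices its
new top. From k = b on, the reserve is empty and the ladder shrinks from above while shifting up. -/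
lemma exists_profile_eq_add {a b x k : ℕ} (hba : b ≤ a) (hk : 0 < k) (hkb : k < 2 * b) :
    ∃ A B, profile a b x k = A + B ∧ A.sum = a ∧
      Multiset.replicate (Multiset.card A - 1) 1 + B.map (· + 1) = profile a b x (k + 1) := by
  rcases lt_trichotomy k b with h | rfl | h
  · obtain ⟨t, rfl⟩ : ∃ t, b = k + 1 + t := ⟨b - (k + 1), by omega⟩
    obtain ⟨s, rfl⟩ : ∃ s, a = k + 1 + t + s := ⟨a - (k + 1 + t), by omega⟩
    obtain ⟨j, rfl⟩ : ∃ j, k = j + 1 := ⟨k - 1, by omega⟩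
    refine ⟨(j + 1) ::ₘ Multiset.replicate (1 + t + s) 1,
      Multiset.replicate (t + 1) (j + 1) + ladder 1 j + Multiset.replicate x (j + 1), ?_, ?_, ?_⟩
    · rw [profile, if_pos (by omega), ladder_succ,
        show j + 1 + 1 + t + s - (j + 1) = 1 + t + s by omega,
        show j + 1 + 1 + t - (j + 1) = t + 1 by omega]
      simp only [← Multiset.singleton_add]
      abel
    · simp; omega
    · rw [profile, if_pos (by omega), ladder_succ', ladder_succ, Multiset.card_cons,
        Multiset.card_replicate, Multiset.map_add, Multiset.map_add, Multiset.map_replicate,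
        Multiset.map_replicate, map_ladder,
        show j + 1 + 1 + t + s - (j + 1 + 1) = t + s by omega,
        show j + 1 + 1 + t - (j + 1 + 1) = t by omega,
        show 1 + t + s + 1 - 1 = (t + s) + 1 by omega,
        Multiset.replicate_succ, Multiset.replicate_succ]
      simp only [← Multiset.singleton_add]
      rw [show j + (1 + 1) = j + 1 + 1 by omega]
      abel
  · obtain ⟨s, rfl⟩ : ∃ s, a = k + s := ⟨a - k, by omega⟩
    obtain ⟨j, rfl⟩ : ∃ j, k = j + 1 := ⟨k - 1, by omega⟩
    refine ⟨(j + 1) ::ₘ Multiset.replicate s 1, ladder 1 j + Multiset.replicate x (j + 1),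
      ?_, ?_, ?_⟩
    · rw [profile, if_pos le_rfl, ladder_succ, show j + 1 + s - (j + 1) = s by omega, Nat.sub_self,
        Multiset.replicate_zero]
      simp only [← Multiset.singleton_add]
      abel
    · simp
    · rw [profile, if_neg (by omega), Multiset.card_cons, Multiset.card_replicate,
        Multiset.map_add, Multiset.map_replicate, map_ladder,
        show j + 1 + s - (j + 1) = s by omega,
        show 2 * (j + 1) - (j + 1 + 1) = j by omega,
        show j + 1 + 1 - (j + 1) + 1 = 1 + 1 by omega, Nat.add_sub_cancel, ← add_assoc (Multiset.replicate s 1)]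
  · obtain ⟨s, rfl⟩ : ∃ s, a = b + s := ⟨a - b, by omega⟩
    obtain ⟨t, ht⟩ : ∃ t, 2 * b - k = t + 1 := ⟨2 * b - k - 1, by omega⟩
    refine ⟨b ::ₘ Multiset.replicate s 1, ladder (k - b + 1) t + Multiset.replicate x k,
      ?_, ?_, ?_⟩
    · rw [profile, if_neg (by omega), ht, ladder_succ, show b + s - b = s by omega,
        show t + (k - b + 1) = b by omega]
      simp only [← Multiset.singleton_add]
      abel
    · simp
    · rw [profile, if_neg (by omega), Multiset.card_cons, Multiset.card_replicate,
        Multiset.map_add, Multiset.map_replicate, map_ladder,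
        show b + s - b = s by omega, show 2 * b - (k + 1) = t by omega,
        show k + 1 - b = k - b + 1 by omega, Nat.add_sub_cancel, ← add_assoc (Multiset.replicate s 1)]

lemma le_of_mem_profile {a b x k d : ℕ} (hk : k = 2 * b) (hb : 0 < b) (hab : a = b)
    (hd : d ∈ profile a b x k) : a ≤ d := by
  subst hab hk
  rw [profile, if_neg (by omega), Nat.sub_self, Nat.sub_self, ladder_zero, Multiset.replicate_zero,
    zero_add, zero_add] at hd
  rw [Multiset.eq_of_mem_replicate hd]
  omega

/-! ### Waiter's strategy on the complete graph -/

lemma mem_completeEdges {n : ℕ} {u v : Fin n} : s(u, v) ∈ completeEdges n ↔ u ≠ v := by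
  simp [completeEdges]

lemma freeDegrees_completeEdges {n : ℕ} (v : Fin n) :
    freeDegrees (completeEdges n) {v} = Multiset.replicate (n - 1) 1 := by
  rw [freeDegrees, Multiset.eq_replicate]
  constructor
  · rw [Multiset.card_map, ← Finset.card_def, Finset.card_compl, Fintype.card_fin,
      Finset.card_singleton]
  · intro d hd
    obtain ⟨u, hu, rfl⟩ := Multiset.mem_map.1 hd
    have hu' : u ∈ ({v} : Finset (Fin n))ᶜ := hu
    rw [Finset.mem_compl, Finset.mem_singleton] at hu'
    rw [freeNeighbors, Finset.filter_singleton, if_pos (mem_completeEdges.2 hu'),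
      Finset.card_singleton]

lemma card_le_largestComponentOrder {n : ℕ} {G : SimpleGraph (Fin n)} {C : Finset (Fin n)}
    (h : ∀ u ∈ C, ∀ v ∈ C, G.Reachable u v) : C.card ≤ largestComponentOrder G := by
  rcases C.eq_empty_or_nonempty with rfl | ⟨u, hu⟩
  · simp
  · have h1 : C.card ≤ (G.connectedComponentMk u).supp.ncard := by
      rw [← Set.ncard_coe_finset]
      refine Set.ncard_le_ncard (fun v hv => ?_) (Set.toFinite _)
      exact SimpleGraph.ConnectedComponent.sound (h v hv u hu)
    exact h1.trans (le_ciSup (f := fun K : G.ConnectedComponent => K.supp.ncard)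
      (Set.finite_range _).bddAbove _)

/-- Waiter can force a component of order `min n (2 * (n - q - 1))`. -/
theorem exists_waiterStrategy_le_largestComponentOrder {n q : ℕ} (hn : 3 ≤ n) (hq : q + 1 < n) :
    ∃ W : WaiterStrategy (completeEdges n) q, ∀ C : ClientStrategy (Sym2 (Fin n)),
      min n (2 * (n - (q + 1))) ≤ largestComponentOrder (clientGraph W C) := by
  obtain ⟨a, ha⟩ : ∃ a, a = q + 1 := ⟨_, rfl⟩
  obtain ⟨b, hb⟩ : ∃ b, b = min (n - a) a := ⟨_, rfl⟩
  obtain ⟨m, hm⟩ : ∃ m, m = min n (2 * (n - a)) := ⟨_, rfl⟩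
  -- Growing from one vertex to `m` takes m - 1 rounds, which must fit into the |X| steps after
  -- which the outcome is read off.
  have hcard : m - 1 ≤ (completeEdges n).card := by
    have h1 : (completeEdges n).card = n.choose 2 := by
      rw [completeEdges, SimpleGraph.card_edgeFinset_top_eq_card_choose_two, Fintype.card_fin]
    obtain ⟨j, rfl⟩ : ∃ j, n = j + 1 := ⟨n - 1, by omega⟩
    rw [h1, Nat.choose_succ_succ', Nat.choose_one_right]
    omega
  refine Exists.imp ?_ (exists_waiterStrategy (X := completeEdges n) (q := q) (m := m - 1)
    (fun i F G => ∃ C : Finset (Fin n), C.card = i + 1 ∧ IsGrowing C F G ∧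
      (i + 1 ≤ 2 * b ∧ freeDegrees F C = profile a b (n - a - b) (i + 1) ∨
        ∀ d ∈ freeDegrees F C, a ≤ d)) ?_ ?_ hcard)
  · intro W hW C
    obtain ⟨F, G, ⟨D, hD, hgrow, _⟩, hG⟩ := hW C
    rw [← ha, ← hm, show m = D.card by omega]
    refine card_le_largestComponentOrder fun u hu v hv => ?_
    exact (hgrow.reachable u hu v hv).mono (SimpleGraph.fromEdgeSet_mono (by exact_mod_cast hG))
  · refine ⟨{⟨0, by omega⟩}, by simp, ⟨?_, ?_⟩, Or.inl ⟨by omega, ?_⟩⟩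
    · intro u hu v hv
      rw [Finset.mem_singleton.1 hu, Finset.mem_singleton.1 hv]
    · exact fun u _ v _ huv => mem_completeEdges.2 huv
    -- At order 1 all entries of the profile equal 1, and (a - 1) + (b - 1) + 1 + (n - a - b) = n -
    -- 1.
    · rw [freeDegrees_completeEdges, profile, if_pos (by omega), zero_add, ladder_succ', ladder_zero,
        show (1 ::ₘ 0 : Multiset ℕ) = Multiset.replicate 1 1 from rfl]
      simp only [← Multiset.replicate_add]
      congr 1
      omega
  · rintro i F G hi ⟨C, hC, hgrow, hprof⟩
    have hlate : (∀ d ∈ freeDegrees F C, a ≤ d) → ∃ S ⊆ F, S.card = q + 1 ∧ ∀ e ∈ S,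
        ∃ C' : Finset (Fin n), C'.card = i + 1 + 1 ∧ IsGrowing C' (F \ S) (insert e G) ∧
        (i + 1 + 1 ≤ 2 * b ∧ freeDegrees (F \ S) C' = profile a b (n - a - b) (i + 1 + 1) ∨
          ∀ d ∈ freeDegrees (F \ S) C', a ≤ d) := by
      intro hd
      obtain ⟨S, hS, hSc, hSe⟩ := hgrow.exists_offer_one (by rw [Fintype.card_fin]; omega) hd
      refine ⟨S, hS, by omega, fun e he => ?_⟩
      obtain ⟨C', h1, h2, h3⟩ := hSe e he
      exact ⟨C', by omega, h2, Or.inr h3⟩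
    rcases hprof with ⟨hib, hprof⟩ | hd
    · rcases hib.lt_or_eq with hlt | heq
      · obtain ⟨A, B, h1, h2, h3⟩ := exists_profile_eq_add (a := a) (b := b) (x := n - a - b)
          (k := i + 1) (by omega) (by omega) hlt
        obtain ⟨S, hS, hSc, hSe⟩ := hgrow.exists_offer (hprof.trans h1)
        refine ⟨S, hS, by omega, fun e he => ?_⟩
        obtain ⟨C', h4, h5, h6⟩ := hSe e he
        exact ⟨C', by omega, h5, Or.inl ⟨by omega, h6.trans h3⟩⟩
      -- Order 2b is reached but is below `m`, which excludes b = n - a. So b = a, the ones have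
      -- vanished, and all free degrees are 2a.
      · refine hlate fun d hd => ?_
        rw [hprof] at hd
        exact le_of_mem_profile heq (by omega) (by omega) hd
    · exact hlate hd

end WaiterClient
theorem theorem1p1 :
    ∃ c : ℝ, 0 < c ∧ ∃ n₀ : ℕ, ∀ n : ℕ, n₀ ≤ n → ∀ ε : ℝ, 0 < ε → ε < 1 → ∀ q : ℕ,
      ((1 + ε) * (n : ℝ) ≤ (q : ℝ) →
        ∃ C : WaiterClient.ClientStrategy (Sym2 (Fin n)),
          ∀ W : WaiterClient.WaiterStrategy (WaiterClient.completeEdges n) q,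
            (WaiterClient.largestComponentOrder (WaiterClient.clientGraph W C) : ℝ)
              ≤ c * (ε ^ 2)⁻¹ * Real.log (n : ℝ)) ∧
      ((q : ℝ) ≤ (1 - ε) * (n : ℝ) →
        ∃ W : WaiterClient.WaiterStrategy (WaiterClient.completeEdges n) q,
          ∀ C : WaiterClient.ClientStrategy (Sym2 (Fin n)),
            min (n : ℝ) (2 * ε * (n : ℝ) - 2)
              ≤ (WaiterClient.largestComponentOrder (WaiterClient.clientGraph W C) : ℝ)) := by
  refine ⟨120, by norm_num, 3, fun n hn ε hε hε1 q => ⟨fun hq => ?_, fun hq => ?_⟩⟩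
  · exact WaiterClient.exists_clientStrategy_largestComponentOrder_le hn hε hε1 hq
  · have hn0 : (0 : ℝ) < n := by exact_mod_cast (by omega : 0 < n)
    rcases lt_or_ge (q + 1) n with h | h
    · obtain ⟨W, hW⟩ := WaiterClient.exists_waiterStrategy_le_largestComponentOrder hn h
      refine ⟨W, fun C => le_trans ?_ (Nat.cast_le.2 (hW C))⟩
      rw [Nat.cast_min, Nat.cast_mul, Nat.cast_sub h.le]
      push_cast
      exact min_le_min le_rfl (by linarith)
    -- If q + 1 ≥ n, then εn ≤ n - q ≤ 1, so the claimed bound is at most 0 and any strategy serves.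
    · obtain ⟨W, -⟩ := WaiterClient.exists_waiterStrategy (X := WaiterClient.completeEdges n)
        (q := q) (m := 0) (fun _ _ _ => True) trivial (by simp) (Nat.zero_le _)
      refine ⟨W, fun C => (min_le_right _ _).trans (le_trans ?_ (Nat.cast_nonneg _))⟩
      have : (n : ℝ) ≤ q + 1 := by exact_mod_cast h
      linarith
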